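/- Let $0<p\le 1$ and let $\mathbb K$ be $\mathbb R$ or $\mathbb C$. A $p$-normed space is a $\mathbb K$-linear space $X$ with a function $\|\cdot\|:X\to[0,\infty)$ such that $\|x\|=0$ only for $x=0$, $\|\lambda x\|=|\lambda|\,\|x\|$ and $\|x+y\|^p\le\|x\|^p+\|y\|^p$; it carries the metric $\|x-y\|^p$, and it is a $p$-Banach space if it is complete. A linear map $f:X\to Y$ is an isometry if $\|f(x)\|=\|x\|$ for all $x\in X$ (it need not be surjective), and an $\varepsilon$-isometry, for $0\le\varepsilon<1$, if $(1-\varepsilon)\|x\|\le\|f(x)\|\le(1+\varepsilon)\|x\|$ for all $x\in X$. Let $\mathbb G_p$ be the $p$-Gurariĭ space, that is, the (unique up to isometry) separable $p$-Banach space of almost universal disposition for finite-dimensional $p$-Banach spaces: whenever $X$ is a linear subspace of $\mathbb G_p$, $Y$ is a finite-dimensional $p$-Banach space, $g:X\to Y$ is an isometry and $0<\varepsilon<1$, there is an $\varepsilon$-isometry $f:Y\to\mathbb G_p$ such that $f(g(x))=x$ for all $x\in X$. Let $\mathscr U$ be a countably incomplete ultrafilter on $\mathbb Z$, that is, there are $J_n\in\mathscr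 U$ $(n\in\mathbb N)$ with $\bigcap_n J_n=\varnothing$. Let $[\mathbb G_p]_{\mathscr U}=\ell_\infty(\mathbb Z,\mathbb G_p)/c_0^{\mathscr U}(\mathbb G_p)$ be the ultrapower, where $\ell_\infty(\mathbb Z,\mathbb G_p)$ is the space of bounded families with the quasinorm $\sup_i\|x_i\|$, $c_0^{\mathscr U}(\mathbb G_p)$ is its subspace of families with $\lim_{\mathscr U}\|x_i\|=0$, and the quotient carries the quotient quasinorm. Then $[\mathbb G_p]_{\mathscr U}$ is a $p$-Banach space; it is of universal disposition for separable $p$-Banach spaces, that is, whenever $X$ is a linear subspace of $[\mathbb G_p]_{\mathscr U}$, $Y$ is a separable $p$-Banach space and $g:X\to Y$ is an isometry, there is an isometry $f:Y\to[\mathbb G_p]_{\mathscr U}$ such that $f(g(x))=x$ for all $x\in X$; and its density character, the least cardinality of a dense subset, is the continuum $2^{\aleph_0}$. -/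

import Mathlib

open Filter Topology Cardinal

universe u w

/-- `X` is a `p`-normed space over `𝕜` (the reals or the complex numbers), where `0 < p ≤ 1`.
The function `‖·‖` is a `p`-norm, and the metric is the one it induces, `dist x y = ‖x - y‖ ^ p`,
so that topological notions on `X` (completeness, separability, density) are those of the `p`-norm.
A `p`-Banach space is a `p`-normed space that is a `CompleteSpace`. -/
class IsPNormedSpace (p : ℝ) (𝕜 : Type) (X : Type*) [RCLike 𝕜] [AddCommGroup X] [Module 𝕜 X]
    [Norm X] [MetricSpace X] : Prop where
  p_pos : 0 < p
  p_le_one : p ≤ 1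
  norm_nonneg : ∀ x : X, 0 ≤ ‖x‖
  eq_zero_of_norm_eq_zero : ∀ x : X, ‖x‖ = 0 → x = 0
  norm_smul : ∀ (c : 𝕜) (x : X), ‖c • x‖ = ‖c‖ * ‖x‖
  norm_add_rpow_le : ∀ x y : X, ‖x + y‖ ^ p ≤ ‖x‖ ^ p + ‖y‖ ^ p
  dist_eq : ∀ x y : X, dist x y = ‖x - y‖ ^ p

/-- `U` is of almost universal disposition for finite-dimensional `p`-Banach spaces: for every
`ε ∈ (0, 1)` and every isometry `g : X → Y` from a subspace `X` of `U` to a finite-dimensional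
`p`-Banach space `Y` there is an `ε`-isometry `f : Y → U` with `f (g x) = x` on `X`. -/
def IsOfAlmostUniversalDisposition (p : ℝ) (𝕜 : Type) [RCLike 𝕜] (U : Type u)
    [AddCommGroup U] [Module 𝕜 U] [Norm U] : Prop :=
  ∀ (Y : Type w) [AddCommGroup Y] [Module 𝕜 Y] [Norm Y] [MetricSpace Y] [IsPNormedSpace p 𝕜 Y]
    [CompleteSpace Y] [FiniteDimensional 𝕜 Y] (X : Submodule 𝕜 U) (g : X →ₗ[𝕜] Y),
    (∀ x : X, ‖g x‖ = ‖(x : U)‖) →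
    ∀ ε : ℝ, 0 < ε → ε < 1 →
      ∃ f : Y →ₗ[𝕜] U, (∀ y : Y, (1 - ε) * ‖y‖ ≤ ‖f y‖ ∧ ‖f y‖ ≤ (1 + ε) * ‖y‖) ∧
        ∀ x : X, f (g x) = (x : U)

/-- `U` is of universal disposition for separable `p`-Banach spaces: for every isometry
`g : X → Y` from a subspace `X` of `U` to a separable `p`-Banach space `Y` there is an isometry
`f : Y → U` with `f (g x) = x` on `X`. -/
def IsOfSeparableUniversalDisposition (p : ℝ) (𝕜 : Type) [RCLike 𝕜] (U : Type u)
    [AddCommGroup U] [Module 𝕜 U] [Norm U] : Prop :=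
  ∀ (Y : Type w) [AddCommGroup Y] [Module 𝕜 Y] [Norm Y] [MetricSpace Y] [IsPNormedSpace p 𝕜 Y]
    [CompleteSpace Y] [TopologicalSpace.SeparableSpace Y] (X : Submodule 𝕜 U) (g : X →ₗ[𝕜] Y),
    (∀ x : X, ‖g x‖ = ‖(x : U)‖) →
      ∃ f : Y →ₗ[𝕜] U, (∀ y : Y, ‖f y‖ = ‖y‖) ∧ ∀ x : X, f (g x) = (x : U)

/-- The density character: the least cardinality of a dense subset. -/
noncomputable def densityCharacter (X : Type u) [TopologicalSpace X] : Cardinal.{u} :=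
  sInf {κ : Cardinal.{u} | ∃ s : Set X, Dense s ∧ #s = κ}

/-- An ultrafilter is countably incomplete if it contains a sequence of sets with empty
intersection. -/
def IsCountablyIncomplete {I : Type*} (U : Ultrafilter I) : Prop :=
  ∃ J : ℕ → Set I, (∀ n, J n ∈ U) ∧ ⋂ n, J n = ∅

theorem pnorm_zero (p : ℝ) (𝕜 : Type) (X : Type*) [RCLike 𝕜] [AddCommGroup X] [Module 𝕜 X]
    [Norm X] [MetricSpace X] [h : IsPNormedSpace p 𝕜 X] : ‖(0 : X)‖ = 0 := by
  simpa using h.norm_smul 0 0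

section Ultrapower

variable (p : ℝ) (𝕜 : Type) [RCLike 𝕜] (X : Type*) [AddCommGroup X] [Module 𝕜 X]
  [Norm X] [MetricSpace X] [h : IsPNormedSpace p 𝕜 X] {I : Type*}

variable (I) in
/-- The space `ℓ_∞(I, X)` of bounded families. -/
def boundedFamilies : Submodule 𝕜 (I → X) where
  carrier := {x | BddAbove (Set.range fun i => ‖x i‖)}
  zero_mem' := ⟨0, by rintro _ ⟨i, rfl⟩; simp [pnorm_zero p 𝕜 X]⟩
  add_mem' := by
    rintro x y ⟨A, hA⟩ ⟨B, hB⟩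
    refine ⟨(A ^ p + B ^ p) ^ p⁻¹, ?_⟩
    rintro _ ⟨i, rfl⟩
    have hx : ‖x i‖ ≤ A := hA ⟨i, rfl⟩
    have hy : ‖y i‖ ≤ B := hB ⟨i, rfl⟩
    have h0 := h.norm_nonneg (x i)
    have h1 := h.norm_nonneg (y i)
    have hp := h.p_pos
    show ‖x i + y i‖ ≤ _
    rw [Real.le_rpow_inv_iff_of_pos (h.norm_nonneg _)
      (add_nonneg (Real.rpow_nonneg (h0.trans hx) _) (Real.rpow_nonneg (h1.trans hy) _)) hp]
    refine (h.norm_add_rpow_le _ _).trans ?_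
    gcongr
  smul_mem' := by
    rintro c x ⟨A, hA⟩
    refine ⟨‖c‖ * A, ?_⟩
    rintro _ ⟨i, rfl⟩
    show ‖c • x i‖ ≤ _
    rw [h.norm_smul]
    exact mul_le_mul_of_nonneg_left (hA ⟨i, rfl⟩) (norm_nonneg _)

/-- The subspace `c_0^U(X)` of the bounded families with `lim_U ‖x i‖ = 0`. -/
def nullFamilies (U : Ultrafilter I) : Submodule 𝕜 (boundedFamilies p 𝕜 X I) where
  carrier := {x | Tendsto (fun i => ‖x.1 i‖) U (𝓝 0)}
  zero_mem' := by
    show Tendsto (fun _ : I => ‖(0 : X)‖) U (𝓝 0)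
    rw [pnorm_zero p 𝕜 X]
    exact tendsto_const_nhds
  add_mem' := by
    intro x y hx hy
    have hp := h.p_pos
    have key : ∀ z : boundedFamilies p 𝕜 X I, Tendsto (fun i => ‖z.1 i‖) U (𝓝 0) →
        Tendsto (fun i => ‖z.1 i‖ ^ p) U (𝓝 0) := fun z hz => by
      simpa [Real.zero_rpow hp.ne'] using hz.rpow_const (p := p) (Or.inr hp.le)
    have h1 : Tendsto (fun i => ‖x.1 i + y.1 i‖ ^ p) U (𝓝 0) :=
      squeeze_zero (fun i => Real.rpow_nonneg (h.norm_nonneg _) _)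
        (fun i => h.norm_add_rpow_le _ _) (by simpa using (key x hx).add (key y hy))
    have h2 := h1.rpow_const (p := p⁻¹) (Or.inr (inv_pos.2 hp).le)
    rw [Real.zero_rpow (inv_pos.2 hp).ne'] at h2
    refine h2.congr fun i => ?_
    exact Real.rpow_rpow_inv (h.norm_nonneg _) hp.ne'
  smul_mem' := by
    intro c x hx
    have : Tendsto (fun i => ‖c‖ * ‖x.1 i‖) U (𝓝 0) := by
      simpa using Tendsto.const_mul ‖c‖ hx
    exact this.congr fun i => (h.norm_smul c (x.1 i)).symm

/-- The ultrapower `[X]_U`, that is, the quotient `ℓ_∞(I, X) / c_0^U(X)`. -/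
def Ultrapower (U : Ultrafilter I) : Type _ :=
  boundedFamilies p 𝕜 X I ⧸ nullFamilies p 𝕜 X U

variable {X}

/-- The quasinorm `sup_i ‖x i‖` of `ℓ_∞(I, X)`. -/
noncomputable def supNorm (x : boundedFamilies p 𝕜 X I) : ℝ := ⨆ i, ‖x.1 i‖

namespace Ultrapower

variable {p 𝕜} {U : Ultrafilter I}

noncomputable instance : AddCommGroup (Ultrapower p 𝕜 X U) :=
  inferInstanceAs (AddCommGroup (boundedFamilies p 𝕜 X I ⧸ nullFamilies p 𝕜 X U))

noncomputable instance : Module 𝕜 (Ultrapower p 𝕜 X U) :=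
  inferInstanceAs (Module 𝕜 (boundedFamilies p 𝕜 X I ⧸ nullFamilies p 𝕜 X U))

/-- The quotient map, `(x i) ↦ [(x i)]`. -/
noncomputable def mk : boundedFamilies p 𝕜 X I →ₗ[𝕜] Ultrapower p 𝕜 X U :=
  (nullFamilies p 𝕜 X U).mkQ

/-- The quotient quasinorm: the infimum of the quasinorms of the representatives. -/
noncomputable instance : Norm (Ultrapower p 𝕜 X U) where
  norm q := sInf {r : ℝ | ∃ x : boundedFamilies p 𝕜 X I, mk x = q ∧ supNorm p 𝕜 x = r}

theorem mk_surjective : Function.Surjective (mk : _ → Ultrapower p 𝕜 X U) :=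
  (nullFamilies p 𝕜 X U).mkQ_surjective

theorem mk_eq_zero_iff (x : boundedFamilies p 𝕜 X I) :
    (mk x : Ultrapower p 𝕜 X U) = 0 ↔ Tendsto (fun i => ‖x.1 i‖) U (𝓝 0) :=
  Submodule.Quotient.mk_eq_zero (nullFamilies p 𝕜 X U)

theorem supNorm_nonneg (x : boundedFamilies p 𝕜 X I) : 0 ≤ supNorm p 𝕜 x :=
  Real.iSup_nonneg fun i => h.norm_nonneg (x.1 i)

theorem le_supNorm (x : boundedFamilies p 𝕜 X I) (i : I) : ‖x.1 i‖ ≤ supNorm p 𝕜 x :=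
  le_ciSup x.2 i

theorem norm_nonneg' (q : Ultrapower p 𝕜 X U) : 0 ≤ ‖q‖ :=
  Real.sInf_nonneg (by rintro _ ⟨x, -, rfl⟩; exact supNorm_nonneg x)

theorem norm_mk_le (x : boundedFamilies p 𝕜 X I) :
    ‖(mk x : Ultrapower p 𝕜 X U)‖ ≤ supNorm p 𝕜 x :=
  csInf_le ⟨0, by rintro _ ⟨y, -, rfl⟩; exact supNorm_nonneg y⟩ ⟨x, rfl, rfl⟩

theorem exists_lt (q : Ultrapower p 𝕜 X U) {r : ℝ} (hr : ‖q‖ < r) :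
    ∃ x : boundedFamilies p 𝕜 X I, mk x = q ∧ supNorm p 𝕜 x < r := by
  obtain ⟨x, hx⟩ := mk_surjective q
  obtain ⟨_, ⟨y, hy, rfl⟩, hlt⟩ := exists_lt_of_csInf_lt
    (s := {r : ℝ | ∃ x : boundedFamilies p 𝕜 X I, mk x = q ∧ supNorm p 𝕜 x = r})
    ⟨_, x, hx, rfl⟩ hr
  exact ⟨y, hy, hlt⟩

theorem norm_zero' : ‖(0 : Ultrapower p 𝕜 X U)‖ = 0 := by
  refine le_antisymm ?_ (norm_nonneg' 0)
  have := norm_mk_le (U := U) (0 : boundedFamilies p 𝕜 X I)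
  rw [map_zero] at this
  refine this.trans ?_
  simp [supNorm, pnorm_zero p 𝕜 X]

theorem norm_neg' (q : Ultrapower p 𝕜 X U) : ‖-q‖ = ‖q‖ := by
  have hneg : ∀ y : X, ‖-y‖ = ‖y‖ := fun y => by
    simpa using h.norm_smul (-1) y
  have key : ∀ q : Ultrapower p 𝕜 X U, ‖-q‖ ≤ ‖q‖ := fun q => by
    refine le_of_forall_gt_imp_ge_of_dense fun r hr => ?_
    obtain ⟨x, rfl, hx⟩ := exists_lt q hr
    have h1 := norm_mk_le (U := U) (-x)
    have h2 : supNorm p 𝕜 (-x) = supNorm p 𝕜 x := by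
      show (⨆ i, ‖-(x.1 i)‖) = ⨆ i, ‖x.1 i‖
      simp only [hneg]
    rw [map_neg, h2] at h1
    exact h1.trans hx.le
  refine le_antisymm (key q) ?_
  simpa using key (-q)

theorem supNorm_add_rpow_le (x y : boundedFamilies p 𝕜 X I) :
    supNorm p 𝕜 (x + y) ^ p ≤ supNorm p 𝕜 x ^ p + supNorm p 𝕜 y ^ p := by
  have hp := h.p_pos
  have hb : 0 ≤ supNorm p 𝕜 x ^ p + supNorm p 𝕜 y ^ p :=
    add_nonneg (Real.rpow_nonneg (supNorm_nonneg x) _) (Real.rpow_nonneg (supNorm_nonneg y) _)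
  rw [← Real.le_rpow_inv_iff_of_pos (supNorm_nonneg _) hb hp]
  refine Real.iSup_le (fun i => ?_) (Real.rpow_nonneg hb _)
  rw [Real.le_rpow_inv_iff_of_pos (h.norm_nonneg _) hb hp]
  refine (h.norm_add_rpow_le (x.1 i) (y.1 i)).trans ?_
  have h0 := h.norm_nonneg (x.1 i)
  have h1 := h.norm_nonneg (y.1 i)
  have hx := le_supNorm x i
  have hy := le_supNorm y i
  gcongr

theorem norm_add_rpow_le' (q r : Ultrapower p 𝕜 X U) : ‖q + r‖ ^ p ≤ ‖q‖ ^ p + ‖r‖ ^ p := by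
  have hp := h.p_pos
  have hbound : ∀ ε : ℝ, 0 < ε → ‖q + r‖ ^ p ≤ (‖q‖ + ε) ^ p + (‖r‖ + ε) ^ p := fun ε hε => by
    obtain ⟨x, rfl, hx⟩ := exists_lt q (lt_add_of_pos_right ‖q‖ hε)
    obtain ⟨y, rfl, hy⟩ := exists_lt r (lt_add_of_pos_right ‖r‖ hε)
    have h0 := norm_nonneg' (mk x + mk y : Ultrapower p 𝕜 X U)
    have h1 := norm_mk_le (U := U) (x + y)
    rw [map_add] at h1
    have hx0 := supNorm_nonneg x
    have hy0 := supNorm_nonneg y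
    calc ‖(mk x + mk y : Ultrapower p 𝕜 X U)‖ ^ p ≤ supNorm p 𝕜 (x + y) ^ p := by gcongr
      _ ≤ supNorm p 𝕜 x ^ p + supNorm p 𝕜 y ^ p := supNorm_add_rpow_le x y
      _ ≤ _ := by gcongr
  have hlim : Tendsto (fun ε : ℝ => (‖q‖ + ε) ^ p + (‖r‖ + ε) ^ p) (𝓝[>] 0)
      (𝓝 (‖q‖ ^ p + ‖r‖ ^ p)) := by
    have hc : Continuous fun ε : ℝ => (‖q‖ + ε) ^ p + (‖r‖ + ε) ^ p :=
      ((continuous_const.add continuous_id).rpow_const fun _ => Or.inr hp.le).add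
        ((continuous_const.add continuous_id).rpow_const fun _ => Or.inr hp.le)
    simpa using (hc.tendsto 0).mono_left nhdsWithin_le_nhds
  exact ge_of_tendsto hlim (eventually_mem_nhdsWithin.mono fun ε hε => hbound ε hε)

theorem eq_zero_of_norm_eq_zero' (q : Ultrapower p 𝕜 X U) (hq : ‖q‖ = 0) : q = 0 := by
  have hp := h.p_pos
  obtain ⟨x, rfl⟩ := mk_surjective q
  rw [mk_eq_zero_iff]
  have key : Tendsto (fun i => ‖x.1 i‖ ^ p) U (𝓝 0) := by
    rw [tendsto_order]
    refine ⟨fun a ha => Eventually.of_forall fun i =>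
      ha.trans_le (Real.rpow_nonneg (h.norm_nonneg _) _), fun a ha => ?_⟩
    have hr : 0 < (a / 2) ^ p⁻¹ := Real.rpow_pos_of_pos (half_pos ha) _
    obtain ⟨y, hy, hlt⟩ := exists_lt (mk x : Ultrapower p 𝕜 X U) (hq.trans_lt hr)
    have hd : (mk (x - y) : Ultrapower p 𝕜 X U) = 0 := by rw [map_sub, hy, sub_self]
    rw [mk_eq_zero_iff] at hd
    filter_upwards [hd.eventually_lt_const hr] with i hi
    have e : x.1 i = (x - y).1 i + y.1 i := by
      show x.1 i = (x.1 i - y.1 i) + y.1 i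
      abel
    have pw : ∀ t : ℝ, 0 ≤ t → t < (a / 2) ^ p⁻¹ → t ^ p < a / 2 := fun t h0 ht =>
      (Real.lt_rpow_inv_iff_of_pos h0 (half_pos ha).le hp).1 ht
    calc ‖x.1 i‖ ^ p = ‖(x - y).1 i + y.1 i‖ ^ p := by rw [← e]
      _ ≤ ‖(x - y).1 i‖ ^ p + ‖y.1 i‖ ^ p := h.norm_add_rpow_le _ _
      _ < a / 2 + a / 2 := add_lt_add (pw _ (h.norm_nonneg _) hi)
          (pw _ (h.norm_nonneg _) ((le_supNorm y i).trans_lt hlt))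
      _ = a := add_halves a
  have h2 := key.rpow_const (p := p⁻¹) (Or.inr (inv_pos.2 hp).le)
  rw [Real.zero_rpow (inv_pos.2 hp).ne'] at h2
  exact h2.congr fun i => Real.rpow_rpow_inv (h.norm_nonneg _) hp.ne'

/-- The metric induced by the quotient quasinorm. -/
noncomputable instance : MetricSpace (Ultrapower p 𝕜 X U) where
  dist q r := ‖q - r‖ ^ p
  dist_self q := by
    show ‖q - q‖ ^ p = 0
    rw [sub_self, norm_zero', Real.zero_rpow h.p_pos.ne']
  dist_comm q r := by
    show ‖q - r‖ ^ p = ‖r - q‖ ^ p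
    rw [← norm_neg', neg_sub]
  dist_triangle q r s := by
    show ‖q - s‖ ^ p ≤ ‖q - r‖ ^ p + ‖r - s‖ ^ p
    rw [← sub_add_sub_cancel q r s]
    exact norm_add_rpow_le' _ _
  eq_of_dist_eq_zero := by
    intro q r hqr
    have h1 : ‖q - r‖ = 0 :=
      (Real.rpow_eq_zero (norm_nonneg' _) h.p_pos.ne').1 hqr
    exact sub_eq_zero.1 (eq_zero_of_norm_eq_zero' _ h1)

end Ultrapower

end Ultrapower

/-! The quotient quasinorm of a class is the limit along `U` of the norms of any representative
(`Ultrapower.tendsto_norm_mk`), so a family of maps that are ever better almost isometries yields an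
exact isometry into the ultrapower.

Given an isometry `g : X → Y`, a linear choice of representatives gives maps `L i` into `G` that are
approximately inverse to `g` on its range. On a finite-dimensional piece of that range, compactness
of the sphere makes `L i` a `δ`-isometry for almost every `i` (`eventually_almost_isometry`).
Renorming the surrounding finite-dimensional space turns it into an exact isometry
(`exists_renorming`), which almost universal disposition extends (`exists_extension`). Countable
incompleteness provides saturation (`IsCountablyIncomplete.exists_forall_eventually`): a single
family `f i` meets the requirements of every finite stage for almost all `i`. Its limit is an
isometry on a dense subspace of `Y`, and completeness of the ultrapower extends it to `Y`.

For the density character, the whole ultrapower has at most `𝔠 ^ ℵ₀ = 𝔠` elements. Conversely, `G`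
contains arbitrarily large finite bounded separated sets, and saturation assembles them into a
separated family indexed by `ℕ → Bool`. -/

/-! ### Unbundled `p`-norms and almost isometries in finite dimension. -/

/-- `ν` is a `p`-norm on the `𝕜`-linear space `X`. -/
structure IsPNorm (p : ℝ) (𝕜 : Type) {X : Type*} [RCLike 𝕜] [AddCommGroup X] [Module 𝕜 X]
    (ν : X → ℝ) : Prop where
  p_pos : 0 < p
  p_le_one : p ≤ 1
  nonneg : ∀ x, 0 ≤ ν x
  eq_zero : ∀ x, ν x = 0 → x = 0
  smul : ∀ (c : 𝕜) (x : X), ν (c • x) = ‖c‖ * ν x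
  add_rpow_le : ∀ x y, ν (x + y) ^ p ≤ ν x ^ p + ν y ^ p

namespace IsPNorm

variable {p : ℝ} {𝕜 : Type} {X : Type*} [RCLike 𝕜] [AddCommGroup X] [Module 𝕜 X] {ν : X → ℝ}

theorem zero (h : IsPNorm p 𝕜 ν) : ν 0 = 0 := by
  simpa using h.smul 0 0

theorem neg (h : IsPNorm p 𝕜 ν) (x : X) : ν (-x) = ν x := by
  simpa using h.smul (-1) x

theorem sub_comm (h : IsPNorm p 𝕜 ν) (x y : X) : ν (x - y) = ν (y - x) := by
  rw [← h.neg, neg_sub]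

theorem rpow_nonneg (h : IsPNorm p 𝕜 ν) (x : X) : 0 ≤ ν x ^ p :=
  Real.rpow_nonneg (h.nonneg x) p

theorem smul_rpow (h : IsPNorm p 𝕜 ν) (c : 𝕜) (x : X) : ν (c • x) ^ p = ‖c‖ ^ p * ν x ^ p := by
  rw [h.smul, Real.mul_rpow (norm_nonneg _) (h.nonneg _)]

theorem rpow_le_rpow_iff (h : IsPNorm p 𝕜 ν) (x : X) {a : ℝ} (ha : 0 ≤ a) :
    ν x ^ p ≤ a ^ p ↔ ν x ≤ a :=
  Real.rpow_le_rpow_iff (h.nonneg x) ha h.p_pos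

theorem rpow_le_add_sub (h : IsPNorm p 𝕜 ν) (x y : X) : ν x ^ p ≤ ν y ^ p + ν (x - y) ^ p := by
  simpa using h.add_rpow_le y (x - y)

theorem abs_rpow_sub_rpow_le (h : IsPNorm p 𝕜 ν) (x y : X) :
    |ν x ^ p - ν y ^ p| ≤ ν (x - y) ^ p := by
  have h1 := h.rpow_le_add_sub x y
  have h2 := h.rpow_le_add_sub y x
  rw [h.sub_comm y x] at h2
  rw [abs_le]
  constructor <;> linarith

theorem sum_rpow_le (h : IsPNorm p 𝕜 ν) {ι : Type*} (s : Finset ι) (x : ι → X) :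
    ν (∑ j ∈ s, x j) ^ p ≤ ∑ j ∈ s, ν (x j) ^ p := by
  classical
  induction s using Finset.induction_on with
  | empty => simp [h.zero, Real.zero_rpow h.p_pos.ne']
  | insert a s ha ih =>
    rw [Finset.sum_insert ha, Finset.sum_insert ha]
    exact (h.add_rpow_le _ _).trans (by gcongr)

theorem comp (h : IsPNorm p 𝕜 ν) {Z : Type*} [AddCommGroup Z] [Module 𝕜 Z] (T : Z →ₗ[𝕜] X)
    (hT : Function.Injective T) : IsPNorm p 𝕜 fun z => ν (T z) where
  p_pos := h.p_pos
  p_le_one := h.p_le_one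
  nonneg z := h.nonneg _
  eq_zero z hz := hT (by rw [h.eq_zero _ hz, map_zero])
  smul c z := by rw [map_smul, h.smul]
  add_rpow_le y z := by rw [map_add]; exact h.add_rpow_le _ _

/-- A function that is the `p`-th power of a `p`-norm. -/
theorem of_rpow {M : X → ℝ} (hp : 0 < p) (hp1 : p ≤ 1) (h0 : ∀ x, 0 ≤ M x)
    (h1 : ∀ x, M x = 0 → x = 0) (h2 : ∀ (c : 𝕜) (x : X), M (c • x) ≤ ‖c‖ ^ p * M x)
    (h3 : ∀ x y, M (x + y) ≤ M x + M y) : IsPNorm p 𝕜 fun x => M x ^ p⁻¹ where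
  p_pos := hp
  p_le_one := hp1
  nonneg x := Real.rpow_nonneg (h0 x) _
  eq_zero x hx := h1 x ((Real.rpow_eq_zero (h0 x) (inv_pos.2 hp).ne').1 hx)
  smul c x := by
    have key : M (c • x) = ‖c‖ ^ p * M x := by
      refine le_antisymm (h2 c x) ?_
      rcases eq_or_ne c 0 with rfl | hc
      · simpa [Real.zero_rpow hp.ne'] using h0 0
      -- The reverse inequality is the assumed one for the scalar `c⁻¹` and the vector `c • x`.
      · have h4 := h2 c⁻¹ (c • x)
        rw [smul_smul, inv_mul_cancel₀ hc, one_smul, norm_inv,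
          Real.inv_rpow (norm_nonneg _)] at h4
        have h5 : 0 < ‖c‖ ^ p := Real.rpow_pos_of_pos (norm_pos_iff.2 hc) _
        rwa [inv_mul_eq_div, le_div_iff₀ h5, mul_comm] at h4
    show M (c • x) ^ p⁻¹ = _
    rw [key, Real.mul_rpow (Real.rpow_nonneg (norm_nonneg _) _) (h0 x),
      Real.rpow_rpow_inv (norm_nonneg _) hp.ne']
  add_rpow_le x y := by
    rw [Real.rpow_inv_rpow (h0 _) hp.ne', Real.rpow_inv_rpow (h0 _) hp.ne',
      Real.rpow_inv_rpow (h0 _) hp.ne']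
    exact h3 x y

/-- The metric induced by a `p`-norm. -/
@[reducible]
noncomputable def metricSpace (h : IsPNorm p 𝕜 ν) : MetricSpace X where
  dist x y := ν (x - y) ^ p
  dist_self x := by
    show ν (x - x) ^ p = 0
    rw [sub_self, h.zero, Real.zero_rpow h.p_pos.ne']
  dist_comm x y := by
    show ν (x - y) ^ p = ν (y - x) ^ p
    rw [h.sub_comm]
  dist_triangle x y z := by
    show ν (x - z) ^ p ≤ ν (x - y) ^ p + ν (y - z) ^ p
    rw [← sub_add_sub_cancel x y z]
    exact h.add_rpow_le _ _
  eq_of_dist_eq_zero := by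
    intro x y hxy
    exact sub_eq_zero.1 (h.eq_zero _ ((Real.rpow_eq_zero (h.nonneg _) h.p_pos.ne').1 hxy))

/-- If the `p`-norms of `T i x` converge for all `x`, then they converge locally uniformly. -/
theorem tendsto_of_pointwise (h : IsPNorm p 𝕜 ν) {I : Type*} {l : Filter I} {k : ℕ}
    (T : I → (Fin k → 𝕜) →ₗ[𝕜] X) (μ : (Fin k → 𝕜) → ℝ)
    (hT : ∀ x, Tendsto (fun i => ν (T i x)) l (𝓝 (μ x)))
    {a : I → Fin k → 𝕜} {a₀ : Fin k → 𝕜} (ha : Tendsto a l (𝓝 a₀)) :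
    Tendsto (fun i => ν (T i (a i))) l (𝓝 (μ a₀)) := by
  have hp := h.p_pos
  have hrp : ∀ x, Tendsto (fun i => ν (T i x) ^ p) l (𝓝 (μ x ^ p)) := fun x =>
    (hT x).rpow_const (Or.inr hp.le)
  -- Expanding `a i - a₀` in the standard basis bounds this by finitely many terms, each a null
  -- coefficient times a convergent value.
  have hsmall : Tendsto (fun i => ν (T i (a i) - T i a₀) ^ p) l (𝓝 0) := by
    have hbd : ∀ i, ν (T i (a i) - T i a₀) ^ p ≤
        ∑ j, ‖a i j - a₀ j‖ ^ p * ν (T i (Pi.single j 1)) ^ p := fun i => by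
      rw [← map_sub, LinearMap.pi_apply_eq_sum_univ]
      refine (h.sum_rpow_le _ _).trans (Finset.sum_le_sum fun j _ => ?_)
      rw [h.smul_rpow]
      simp
      apply le_of_eq; congr; ext; simp [Pi.single_apply, eq_comm]
    refine squeeze_zero (fun i => h.rpow_nonneg _) hbd ?_
    have : Tendsto (fun i => ∑ j, ‖a i j - a₀ j‖ ^ p * ν (T i (Pi.single j 1)) ^ p) l
        (𝓝 (∑ j, (0 : ℝ) * μ (Pi.single j 1) ^ p)) := by
      refine tendsto_finsetSum _ fun j _ => Tendsto.mul ?_ (hrp _)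
      have h1 : Tendsto (fun i => ‖a i j - a₀ j‖) l (𝓝 0) := by
        simpa using (((tendsto_pi_nhds.1 ha j).sub_const (a₀ j))).norm
      simpa [Real.zero_rpow hp.ne'] using h1.rpow_const (p := p) (Or.inr hp.le)
    simpa using this
  have hdiff : Tendsto (fun i => ν (T i (a i)) ^ p - ν (T i a₀) ^ p) l (𝓝 0) :=
    squeeze_zero_norm (fun i => h.abs_rpow_sub_rpow_le _ _) hsmall
  have hlim : Tendsto (fun i => ν (T i (a i)) ^ p) l (𝓝 (μ a₀ ^ p)) := by
    simpa using hdiff.add (hrp a₀)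
  have h2 := hlim.rpow_const (p := p⁻¹) (Or.inr (inv_pos.2 hp).le)
  -- `μ` is an arbitrary function, so its nonnegativity has to come from the limit, which requires
  -- `l ≠ ⊥`.
  rcases l.eq_or_neBot with rfl | hl
  · exact tendsto_bot
  have hμ : 0 ≤ μ a₀ := ge_of_tendsto' (hT a₀) fun i => h.nonneg _
  rw [Real.rpow_rpow_inv hμ hp.ne'] at h2
  exact h2.congr fun i => Real.rpow_rpow_inv (h.nonneg _) hp.ne'

/-- If the `p`-norms of `T i x` converge along an ultrafilter to a `p`-norm of `x` for all `x` in a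
finite-dimensional space, then the maps `T i` are eventually `ε`-isometries. -/
theorem eventually_almost_isometry (h : IsPNorm p 𝕜 ν) {I : Type*} (U : Ultrafilter I)
    {F : Type*} [AddCommGroup F] [Module 𝕜 F] [FiniteDimensional 𝕜 F] {μ : F → ℝ}
    (hμ : IsPNorm p 𝕜 μ) (T : I → F →ₗ[𝕜] X)
    (hT : ∀ x, Tendsto (fun i => ν (T i x)) U (𝓝 (μ x))) {ε : ℝ} (hε : 0 < ε) :
    ∀ᶠ i in U, ∀ x, (1 - ε) * μ x ≤ ν (T i x) ∧ ν (T i x) ≤ (1 + ε) * μ x := by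
  by_contra hcon
  rw [← Ultrafilter.eventually_not] at hcon
  let e : F ≃ₗ[𝕜] (Fin (Module.finrank 𝕜 F) → 𝕜) := (Module.finBasis 𝕜 F).equivFun
  have hbad : ∀ᶠ i in U, ∃ a : Fin (Module.finrank 𝕜 F) → 𝕜, ‖a‖ = 1 ∧
      ¬ ((1 - ε) * μ (e.symm a) ≤ ν (T i (e.symm a)) ∧
        ν (T i (e.symm a)) ≤ (1 + ε) * μ (e.symm a)) := by
    filter_upwards [hcon] with i hi
    push Not at hi
    obtain ⟨x, hx⟩ := hi
    have hx0 : x ≠ 0 := by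
      rintro rfl
      simp [hμ.zero, h.zero] at hx
    have hex : 0 < ‖e x‖ := norm_pos_iff.2 (by simpa using hx0)
    refine ⟨((‖e x‖⁻¹ : ℝ) : 𝕜) • e x, ?_, ?_⟩
    · rw [norm_smul, RCLike.norm_ofReal, abs_of_pos (inv_pos.2 hex), inv_mul_cancel₀ hex.ne']
    · rw [map_smul, map_smul, LinearEquiv.symm_apply_apply, hμ.smul, h.smul, RCLike.norm_ofReal,
        abs_of_pos (inv_pos.2 hex), mul_left_comm, mul_left_comm (1 + ε),
        mul_le_mul_iff_right₀ (inv_pos.2 hex), mul_le_mul_iff_right₀ (inv_pos.2 hex)]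
      rintro ⟨h1, h2⟩
      exact absurd h2 (not_le.2 (hx h1))
  obtain ⟨a, ha⟩ := hbad.choice
  -- Failure of the estimate is invariant under scaling, so the bad vectors lie on a compact sphere
  -- and converge along `U`; the limit vector contradicts the convergence of norms.
  have hsph : (U.map a : Filter (Fin (Module.finrank 𝕜 F) → 𝕜)) ≤ 𝓟 (Metric.sphere 0 1) := by
    rw [le_principal_iff, Ultrafilter.mem_coe, Ultrafilter.mem_map]
    filter_upwards [ha] with i hi
    simpa using hi.1
  obtain ⟨a₀, ha₀, hlim⟩ := (isCompact_sphere (0 : Fin (Module.finrank 𝕜 F) → 𝕜) 1)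
    |>.ultrafilter_le_nhds _ hsph
  have hlim' : Tendsto a U (𝓝 a₀) := hlim
  have h1 := h.tendsto_of_pointwise (fun i => (T i).comp e.symm.toLinearMap)
    (fun x => μ (e.symm x)) (fun x => hT _) hlim'
  -- For a constant family the lemma expresses the continuity of `μ` in coordinates.
  have h2 := hμ.tendsto_of_pointwise (fun _ : I => e.symm.toLinearMap)
    (fun x => μ (e.symm x)) (fun x => tendsto_const_nhds) hlim'
  have hne : a₀ ≠ 0 := by
    rintro rfl
    simp at ha₀
  have hpos : 0 < μ (e.symm a₀) :=
    lt_of_le_of_ne (hμ.nonneg _) fun h0 => hne (by simpa using hμ.eq_zero _ h0.symm)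
  have e1 := (h2.const_mul (1 - ε)).eventually_lt h1 (by nlinarith)
  have e2 := h1.eventually_lt (h2.const_mul (1 + ε)) (by nlinarith)
  obtain ⟨i, hi1, hi2, hi3⟩ := (ha.and (e1.and e2)).exists
  exact hi1.2 ⟨hi2.le, hi3.le⟩

end IsPNorm

/-! ### Topological vector space structure of a `p`-normed space. -/

namespace IsPNormedSpace

variable (p : ℝ) (𝕜 : Type) (X : Type*) [RCLike 𝕜] [AddCommGroup X] [Module 𝕜 X]
  [Norm X] [MetricSpace X]

theorem isPNorm [h : IsPNormedSpace p 𝕜 X] : IsPNorm p 𝕜 (fun x : X => ‖x‖) :=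
  ⟨h.p_pos, h.p_le_one, h.norm_nonneg, h.eq_zero_of_norm_eq_zero, h.norm_smul, h.norm_add_rpow_le⟩

/-- `‖·‖` need not be subadditive, but `dist x 0 = ‖x‖ ^ p` is, and it serves as an auxiliary group
norm. -/
theorem isUniformAddGroup [h : IsPNormedSpace p 𝕜 X] : IsUniformAddGroup X := by
  let _ : NormedAddCommGroup X :=
    { norm := fun x => dist x 0
      dist_eq := fun x y => by
        show dist x y = dist (-x + y) 0
        rw [dist_comm, h.dist_eq, h.dist_eq, sub_zero, neg_add_eq_sub] }
  infer_instance

theorem continuous_norm [h : IsPNormedSpace p 𝕜 X] : Continuous fun x : X => ‖x‖ := by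
  have h1 : ∀ x : X, ‖x‖ = dist x 0 ^ p⁻¹ := fun x => by
    rw [h.dist_eq, sub_zero, Real.rpow_rpow_inv (h.norm_nonneg _) h.p_pos.ne']
  simp_rw [h1]
  exact (continuous_id.dist continuous_const).rpow_const
    fun _ => Or.inr (inv_pos.2 h.p_pos).le

theorem continuousSMul [h : IsPNormedSpace p 𝕜 X] : ContinuousSMul 𝕜 X := by
  have hp := h.p_pos
  refine ⟨continuous_iff_continuousAt.2 fun ⟨c, x⟩ => ?_⟩
  show Tendsto (fun z : 𝕜 × X => z.1 • z.2) (𝓝 (c, x)) (𝓝 (c • x))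
  rw [tendsto_iff_dist_tendsto_zero]
  have hbd : ∀ z : 𝕜 × X, dist (z.1 • z.2) (c • x) ≤
      ‖z.1‖ ^ p * dist z.2 x + ‖z.1 - c‖ ^ p * ‖x‖ ^ p := fun z => by
    rw [h.dist_eq, h.dist_eq]
    have e : z.1 • z.2 - c • x = z.1 • (z.2 - x) + (z.1 - c) • x := by
      rw [smul_sub, sub_smul]; abel
    rw [e]
    refine (h.norm_add_rpow_le _ _).trans (le_of_eq ?_)
    rw [h.norm_smul, h.norm_smul, Real.mul_rpow (_root_.norm_nonneg _) (h.norm_nonneg _),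
      Real.mul_rpow (_root_.norm_nonneg _) (h.norm_nonneg _)]
  refine squeeze_zero (fun _ => dist_nonneg) hbd ?_
  have hc : Continuous fun z : 𝕜 × X => ‖z.1‖ ^ p * dist z.2 x + ‖z.1 - c‖ ^ p * ‖x‖ ^ p :=
    ((continuous_fst.norm.rpow_const fun _ => Or.inr hp.le).mul
      (continuous_snd.dist continuous_const)).add
      (((continuous_fst.sub continuous_const).norm.rpow_const fun _ => Or.inr hp.le).mul
        continuous_const)
  simpa [Real.zero_rpow hp.ne'] using hc.tendsto (c, x)

theorem completeSpace_of_finiteDimensional [FiniteDimensional 𝕜 X] [h : IsPNormedSpace p 𝕜 X] : CompleteSpace X := by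
  have := isUniformAddGroup p 𝕜 X
  have := continuousSMul p 𝕜 X
  exact FiniteDimensional.complete 𝕜 X

end IsPNormedSpace

/-! ### Countable saturation. -/

/-- Countable saturation: a decreasing sequence of conditions, each of which is solvable for
`U`-almost all indices, has a simultaneous solution. -/
theorem IsCountablyIncomplete.exists_forall_eventually {I α : Type*} [Nonempty α]
    {U : Ultrafilter I} (hU : IsCountablyIncomplete U) (P : ℕ → I → α → Prop)
    (hanti : ∀ n m i a, n ≤ m → P m i a → P n i a) (hP : ∀ n, ∀ᶠ i in U, ∃ a, P n i a) :
    ∃ a : I → α, ∀ n, ∀ᶠ i in U, P n i (a i) := by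
  classical
  obtain ⟨J, hJ, hJe⟩ := hU
  have hex : ∀ i, ∃ k, i ∉ J k := fun i => by
    by_contra! hcon
    have : i ∈ ⋂ n, J n := Set.mem_iInter.2 hcon
    simp [hJe] at this
  choose N hN hNmin using fun i => (⟨Nat.find (hex i), Nat.find_spec (hex i),
    fun m hm => Nat.find_min (hex i) hm⟩ : ∃ k, i ∉ J k ∧ ∀ m < k, ¬ i ∉ J m)
  -- `N i` is the first `k` with `i ∉ J k`. At the index `i`, the strongest solvable condition of
  -- number at most `N i` is solved; the cap ensures that a strongest one exists.
  let m : I → ℕ := fun i => Nat.findGreatest (fun n => ∃ a, P n i a) (N i)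
  have hc : ∀ i, ∃ a : α, (∃ b, P (m i) i b) → P (m i) i a := fun i => by
    by_cases hb : ∃ b, P (m i) i b
    · exact ⟨hb.choose, fun _ => hb.choose_spec⟩
    · exact ⟨Classical.arbitrary α, fun hb' => absurd hb' hb⟩
  choose a ha using hc
  refine ⟨a, fun n => ?_⟩
  -- Membership in `J 0, …, J n` forces `N i > n`, so that the cap does not interfere with condition
  -- `n`.
  have hJn : ∀ᶠ i in U, ∀ k ∈ Finset.range (n + 1), i ∈ J k :=
    (Filter.eventually_all_finset _).2 fun k _ => hJ k
  filter_upwards [hP n, hJn] with i hi hiJ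
  have hle : n ≤ N i := by
    by_contra! hlt
    exact hN i (hiJ _ (Finset.mem_range.2 (by omega)))
  have h1 : n ≤ m i := Nat.le_findGreatest hle hi
  have h2 : ∃ b, P (m i) i b :=
    Nat.findGreatest_spec (P := fun n => ∃ a, P n i a) hle hi
  exact hanti _ _ _ _ h1 (ha i h2)

/-! ### The norm as an ultralimit, and completeness of the ultrapower. -/

namespace Ultrapower

variable {p : ℝ} {𝕜 : Type} [RCLike 𝕜] {X : Type*} [AddCommGroup X] [Module 𝕜 X]
  [Norm X] [MetricSpace X] [h : IsPNormedSpace p 𝕜 X] {I : Type*} {U : Ultrafilter I}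

theorem mk_eq_mk_of_eventuallyEq {x y : boundedFamilies p 𝕜 X I} (hxy : ∀ᶠ i in U, x.1 i = y.1 i) :
    (mk x : Ultrapower p 𝕜 X U) = mk y := by
  rw [← sub_eq_zero, ← map_sub, mk_eq_zero_iff]
  refine tendsto_const_nhds.congr' ?_
  filter_upwards [hxy] with i hi
  show (0 : ℝ) = ‖x.1 i - y.1 i‖
  rw [hi, sub_self, pnorm_zero p 𝕜 X]

/-- Entries of norm above `C` are replaced by `0`, which leaves the family unchanged almost
everywhere. The maximum with `0` covers the replaced entries. -/
theorem exists_boundedFamily (x : I → X) {C : ℝ} (hx : ∀ᶠ i in U, ‖x i‖ ≤ C) :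
    ∃ y : boundedFamilies p 𝕜 X I, (∀ᶠ i in U, y.1 i = x i) ∧
      ∀ i, ‖y.1 i‖ ≤ max C 0 := by
  classical
  have hb : ∀ i, ‖(if ‖x i‖ ≤ C then x i else 0)‖ ≤ max C 0 := fun i => by
    split_ifs with hi
    · exact hi.trans (le_max_left _ _)
    · rw [pnorm_zero p 𝕜 X]
      exact le_max_right _ _
  refine ⟨⟨fun i => if ‖x i‖ ≤ C then x i else 0, max C 0, ?_⟩, ?_, hb⟩
  · rintro _ ⟨i, rfl⟩
    exact hb i
  · filter_upwards [hx] with i hi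
    simp [hi]

theorem supNorm_le {x : boundedFamilies p 𝕜 X I} {C : ℝ} (hC : 0 ≤ C) (hx : ∀ i, ‖x.1 i‖ ≤ C) :
    supNorm p 𝕜 x ≤ C :=
  Real.iSup_le hx hC

/-- The quotient quasinorm is the limit of the quasinorms along the ultrafilter. -/
theorem tendsto_norm_mk (x : boundedFamilies p 𝕜 X I) :
    Tendsto (fun i => ‖x.1 i‖) U (𝓝 ‖(mk x : Ultrapower p 𝕜 X U)‖) := by
  have hX := IsPNormedSpace.isPNorm p 𝕜 X
  have hp := h.p_pos
  have hIcc : (U.map fun i => ‖x.1 i‖ : Filter ℝ) ≤ 𝓟 (Set.Icc 0 (supNorm p 𝕜 x)) := by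
    rw [le_principal_iff, Ultrafilter.mem_coe, Ultrafilter.mem_map]
    exact Filter.Eventually.of_forall fun i => ⟨h.norm_nonneg _, le_supNorm x i⟩
  obtain ⟨l, hl, hlim⟩ := isCompact_Icc.ultrafilter_le_nhds _ hIcc
  have hlim' : Tendsto (fun i => ‖x.1 i‖) U (𝓝 l) := hlim
  suffices ‖(mk x : Ultrapower p 𝕜 X U)‖ = l by rwa [this]
  refine le_antisymm (le_of_forall_gt_imp_ge_of_dense fun r hr => ?_)
    (le_of_forall_gt_imp_ge_of_dense fun r hr => ?_)
  · obtain ⟨y, hy, hb⟩ := exists_boundedFamily (p := p) (𝕜 := 𝕜) (U := U) x.1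
      ((hlim'.eventually_lt_const hr).mono fun i hi => hi.le)
    rw [← mk_eq_mk_of_eventuallyEq hy]
    rw [max_eq_left (hl.1.trans hr.le)] at hb
    exact (norm_mk_le y).trans (supNorm_le (hl.1.trans hr.le) hb)
  -- Any other representative differs by a null family, so its supremum bounds the limit as well.
  · obtain ⟨y, hy, hlt⟩ := exists_lt _ hr
    have hd : (mk (x - y) : Ultrapower p 𝕜 X U) = 0 := by rw [map_sub, hy, sub_self]
    rw [mk_eq_zero_iff] at hd
    have hd' : Tendsto (fun i => ‖x.1 i - y.1 i‖ ^ p) U (𝓝 0) := by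
      simpa [Real.zero_rpow hp.ne'] using hd.rpow_const (p := p) (Or.inr hp.le)
    have hr0 : 0 ≤ r := (supNorm_nonneg y).trans hlt.le
    have h1 : ∀ i, ‖x.1 i‖ ^ p ≤ r ^ p + ‖x.1 i - y.1 i‖ ^ p := fun i =>
      (hX.rpow_le_add_sub (x.1 i) (y.1 i)).trans (by
        have := (hX.rpow_le_rpow_iff (y.1 i) hr0).2 ((le_supNorm y i).trans hlt.le)
        gcongr)
    have h2 := le_of_tendsto_of_tendsto' (hlim'.rpow_const (p := p) (Or.inr hp.le))
      (hd'.const_add (r ^ p)) h1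
    rw [add_zero] at h2
    exact (Real.rpow_le_rpow_iff hl.1 hr0 hp).1 h2

instance isPNormedSpace : IsPNormedSpace p 𝕜 (Ultrapower p 𝕜 X U) where
  p_pos := h.p_pos
  p_le_one := h.p_le_one
  norm_nonneg := norm_nonneg'
  eq_zero_of_norm_eq_zero := eq_zero_of_norm_eq_zero'
  norm_smul c q := by
    obtain ⟨x, rfl⟩ := mk_surjective q
    have h1 := tendsto_norm_mk (U := U) (c • x)
    rw [map_smul] at h1
    refine tendsto_nhds_unique h1 (((tendsto_norm_mk x).const_mul ‖c‖).congr fun i => ?_)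
    exact (h.norm_smul c (x.1 i)).symm
  norm_add_rpow_le := norm_add_rpow_le'
  dist_eq _ _ := rfl

theorem dist_mk_le {x y : boundedFamilies p 𝕜 X I} {C : ℝ} (hxy : ∀ i, dist (x.1 i) (y.1 i) ≤ C) :
    dist (mk x : Ultrapower p 𝕜 X U) (mk y) ≤ C := by
  have h1 := (tendsto_norm_mk (U := U) (x - y)).rpow_const (p := p) (Or.inr h.p_pos.le)
  rw [map_sub] at h1
  refine le_of_tendsto' h1 fun i => ?_
  have := hxy i
  rwa [h.dist_eq] at this

/-- Closeness in the ultrapower lifts to closeness at every index, for a prescribed representative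
of the first point. This reduces completeness to coordinatewise limits. -/
theorem exists_dist_lt (x : boundedFamilies p 𝕜 X I) (q : Ultrapower p 𝕜 X U) {r : ℝ}
    (hr : dist (mk x) q < r) :
    ∃ y : boundedFamilies p 𝕜 X I, mk y = q ∧ ∀ i, dist (x.1 i) (y.1 i) ≤ r := by
  have hp := h.p_pos
  have hr0 : 0 ≤ r := dist_nonneg.trans hr.le
  have h1 : ‖q - mk x‖ < r ^ p⁻¹ := by
    rw [Real.lt_rpow_inv_iff_of_pos (norm_nonneg' _) hr0 hp]
    rwa [dist_comm] at hr
  obtain ⟨z, hz, hlt⟩ := exists_lt _ h1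
  refine ⟨x + z, by rw [map_add, hz]; abel, fun i => ?_⟩
  rw [dist_comm, h.dist_eq]
  have e : (x + z).1 i - x.1 i = z.1 i := by
    show x.1 i + z.1 i - x.1 i = z.1 i
    abel
  rw [e, ← Real.le_rpow_inv_iff_of_pos (h.norm_nonneg _) hr0 hp]
  exact (le_supNorm z i).trans hlt.le

instance completeSpace [CompleteSpace X] : CompleteSpace (Ultrapower p 𝕜 X U) := by
  have hX := IsPNormedSpace.isPNorm p 𝕜 X
  have hp := h.p_pos
  refine Metric.complete_of_convergent_controlled_sequences (fun n => (1 / 2) ^ n) (by simp)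
    fun q hq => ?_
  have hstep : ∀ (n : ℕ) (x : boundedFamilies p 𝕜 X I), ∃ y : boundedFamilies p 𝕜 X I,
      (mk x : Ultrapower p 𝕜 X U) = q n →
        (mk y : Ultrapower p 𝕜 X U) = q (n + 1) ∧
          ∀ i, dist (x.1 i) (y.1 i) ≤ 1 * (1 / 2) ^ n := fun n x => by
    by_cases hx : (mk x : Ultrapower p 𝕜 X U) = q n
    · obtain ⟨y, hy, hd⟩ := exists_dist_lt x (q (n + 1))
        (by rw [hx]; exact hq n n (n + 1) le_rfl (Nat.le_succ n))
      exact ⟨y, fun _ => ⟨hy, by simpa using hd⟩⟩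
    · exact ⟨x, fun h' => absurd h' hx⟩
  choose s hs using hstep
  obtain ⟨x₀, hx₀⟩ := mk_surjective (q 0)
  let x : ℕ → boundedFamilies p 𝕜 X I := fun n => Nat.rec x₀ s n
  have hx : ∀ n, (mk (x n) : Ultrapower p 𝕜 X U) = q n := fun n => by
    induction n with
    | zero => exact hx₀
    | succ n ih => exact (hs n (x n) ih).1
  have hd : ∀ i n, dist ((x n).1 i) ((x (n + 1)).1 i) ≤ 1 * (1 / 2) ^ n := fun i n =>
    (hs n (x n) (hx n)).2 i
  have hlim : ∀ i, ∃ a, Tendsto (fun n => (x n).1 i) atTop (𝓝 a) := fun i =>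
    cauchySeq_tendsto_of_complete (cauchySeq_of_le_geometric _ _ (by norm_num) (hd i))
  choose a ha using hlim
  have hda : ∀ i n, dist ((x n).1 i) (a i) ≤ 1 * (1 / 2) ^ n / (1 - 1 / 2) := fun i n =>
    dist_le_of_le_geometric_of_tendsto _ _ (by norm_num) (hd i) (ha i) n
  -- The constant `2` is the sum of the geometric series, which bounds the distance from `x₀` to the
  -- limit at each index.
  have hbd : ∀ i, ‖a i‖ ≤ (supNorm p 𝕜 x₀ ^ p + 2) ^ p⁻¹ := fun i => by
    have h0 : 0 ≤ supNorm p 𝕜 x₀ ^ p := Real.rpow_nonneg (supNorm_nonneg _) _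
    rw [Real.le_rpow_inv_iff_of_pos (h.norm_nonneg _) (by positivity) hp]
    refine (hX.rpow_le_add_sub (a i) (x₀.1 i)).trans (add_le_add ?_ ?_)
    · exact (hX.rpow_le_rpow_iff _ (supNorm_nonneg _)).2 (le_supNorm x₀ i)
    · have := hda i 0
      rw [dist_comm, h.dist_eq] at this
      norm_num at this
      exact this
  let b : boundedFamilies p 𝕜 X I := ⟨a, _, by rintro _ ⟨i, rfl⟩; exact hbd i⟩
  refine ⟨mk b, ?_⟩
  rw [tendsto_iff_dist_tendsto_zero]
  have hgeo : Tendsto (fun n : ℕ => 1 * (1 / 2 : ℝ) ^ n / (1 - 1 / 2)) atTop (𝓝 0) := by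
    simpa using ((tendsto_pow_atTop_nhds_zero_of_lt_one (r := (1 / 2 : ℝ)) (by norm_num)
      (by norm_num)).const_mul 1).div_const (1 - 1 / 2)
  refine squeeze_zero (fun _ => dist_nonneg) (fun n => ?_) hgeo
  rw [← hx n]
  exact dist_mk_le fun i => hda i n

end Ultrapower

/-! ### Renorming and extension of almost isometries. -/

namespace IsPNorm

variable {p : ℝ} {𝕜 : Type} [RCLike 𝕜] {F : Type*} [AddCommGroup F] [Module 𝕜 F] {ν : F → ℝ}
  {X : Type*} [AddCommGroup X] [Module 𝕜 X] {μ : X → ℝ}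

/-- Renorming: if `L : E → X` is a `δ`-isometry on a subspace `E` of `F`, then there is a `p`-norm
on `F` that is `δ`-close to the given one and for which `L` is an isometry. -/
theorem exists_renorming (hν : IsPNorm p 𝕜 ν) (hμ : IsPNorm p 𝕜 μ) (E : Submodule 𝕜 F)
    (L : E →ₗ[𝕜] X) {δ : ℝ} (hδ0 : 0 < δ) (hδ1 : δ < 1)
    (hL : ∀ x : E, (1 - δ) * ν x ≤ μ (L x) ∧ μ (L x) ≤ (1 + δ) * ν x) :
    ∃ ν' : F → ℝ, IsPNorm p 𝕜 ν' ∧ (∀ y, (1 - δ) * ν y ≤ ν' y ∧ ν' y ≤ (1 + δ) * ν y) ∧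
      ∀ x : E, ν' x = μ (L x) := by
  have hp := hν.p_pos
  have hd0 : (0 : ℝ) ≤ 1 - δ := by linarith
  have hd1 : (0 : ℝ) ≤ 1 + δ := by linarith
  have hc0 : 0 ≤ (1 - δ) ^ p := Real.rpow_nonneg hd0 _
  have hc1 : 0 ≤ (1 + δ) ^ p := Real.rpow_nonneg hd1 _
  have hcpos : 0 < (1 - δ) ^ p := Real.rpow_pos_of_pos (by linarith) _
  have hc01 : (1 - δ) ^ p ≤ (1 + δ) ^ p := Real.rpow_le_rpow hd0 (by linarith) hp.le
  have hL0 : ∀ x : E, (1 - δ) ^ p * ν x ^ p ≤ μ (L x) ^ p := fun x => by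
    rw [← Real.mul_rpow hd0 (hν.nonneg _)]
    exact Real.rpow_le_rpow (mul_nonneg hd0 (hν.nonneg _)) (hL x).1 hp.le
  have hL1 : ∀ x : E, μ (L x) ^ p ≤ (1 + δ) ^ p * ν x ^ p := fun x => by
    rw [← Real.mul_rpow hd1 (hν.nonneg _)]
    exact Real.rpow_le_rpow (hμ.nonneg _) (hL x).2 hp.le
  -- The infimum over `x` is the `p`-th power of the quotient `p`-norm that `F` inherits from the
  -- pushout of `X` and `(F, (1 + δ) ν)` along `L`. The factor `1 + δ` makes `L` contractive, so
  -- gluing does not shrink the norm on `L(E)`.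
  let B : F → E → ℝ := fun y x => μ (L x) ^ p + (1 + δ) ^ p * ν (y - x) ^ p
  have hB0 : ∀ y x, 0 ≤ B y x := fun y x =>
    add_nonneg (hμ.rpow_nonneg _) (mul_nonneg hc1 (hν.rpow_nonneg _))
  let M : F → ℝ := fun y => ⨅ x, B y x
  have hMle : ∀ y x, M y ≤ B y x := fun y x =>
    ciInf_le ⟨0, by rintro _ ⟨z, rfl⟩; exact hB0 y z⟩ x
  have hM0 : ∀ y, 0 ≤ M y := fun y => Real.iInf_nonneg (hB0 y)
  have hlow : ∀ y, (1 - δ) ^ p * ν y ^ p ≤ M y := fun y => le_ciInf fun x => by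
    have h1 := hν.rpow_le_add_sub y x
    have h2 := mul_le_mul_of_nonneg_left h1 hc0
    have h3 := mul_le_mul_of_nonneg_right hc01 (hν.rpow_nonneg (y - x))
    have h4 := hL0 x
    show _ ≤ μ (L x) ^ p + (1 + δ) ^ p * ν (y - x) ^ p
    linarith
  have hup : ∀ y, M y ≤ (1 + δ) ^ p * ν y ^ p := fun y => by
    refine (hMle y 0).trans (le_of_eq ?_)
    simp [B, hμ.zero, Real.zero_rpow hp.ne']
  have hME : ∀ x : E, M x = μ (L x) ^ p := fun x => by
    refine le_antisymm ((hMle x x).trans (le_of_eq ?_)) (le_ciInf fun z => ?_)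
    · simp [B, hν.zero, Real.zero_rpow hp.ne']
    · refine (hμ.rpow_le_add_sub (L x) (L z)).trans ?_
      have := hL1 (x - z)
      rw [map_sub] at this
      exact add_le_add le_rfl this
  have hN : IsPNorm p 𝕜 fun y => M y ^ p⁻¹ := by
    refine of_rpow hp hν.p_le_one hM0 (fun y hy => ?_) (fun c y => ?_) fun y z => ?_
    · have h1 := hlow y
      rw [hy] at h1
      have h2 : ν y ^ p ≤ 0 := by
        by_contra! hcon
        exact absurd h1 (not_le.2 (mul_pos hcpos hcon))
      exact hν.eq_zero y ((Real.rpow_eq_zero (hν.nonneg y) hp.ne').1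
        (le_antisymm h2 (hν.rpow_nonneg y)))
    · rw [Real.mul_iInf_of_nonneg (Real.rpow_nonneg (norm_nonneg _) _)]
      refine le_ciInf fun x => (hMle _ (c • x)).trans (le_of_eq ?_)
      show μ (L (c • x)) ^ p + (1 + δ) ^ p * ν (c • y - (c • x : E)) ^ p = _
      rw [map_smul, hμ.smul_rpow, Submodule.coe_smul, ← smul_sub, hν.smul_rpow]
      ring
    · refine le_ciInf_add_ciInf fun x x' => (hMle _ (x + x')).trans ?_
      show μ (L (x + x')) ^ p + (1 + δ) ^ p * ν (y + z - (x + x' : E)) ^ p ≤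
        μ (L x) ^ p + (1 + δ) ^ p * ν (y - x) ^ p + (μ (L x') ^ p + (1 + δ) ^ p * ν (z - x') ^ p)
      rw [map_add, Submodule.coe_add, add_sub_add_comm]
      have h1 := hμ.add_rpow_le (L x) (L x')
      have h2 := mul_le_mul_of_nonneg_left (hν.add_rpow_le (y - x) (z - x')) hc1
      linarith
  refine ⟨fun y => M y ^ p⁻¹, hN, fun y => ⟨?_, ?_⟩, fun x => ?_⟩
  · rw [Real.le_rpow_inv_iff_of_pos (mul_nonneg hd0 (hν.nonneg _)) (hM0 y) hp,
      Real.mul_rpow hd0 (hν.nonneg _)]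
    exact hlow y
  · rw [Real.rpow_inv_le_iff_of_pos (hM0 y) (mul_nonneg hd1 (hν.nonneg _)) hp,
      Real.mul_rpow hd1 (hν.nonneg _)]
    exact hup y
  · show M x ^ p⁻¹ = _
    rw [hME, Real.rpow_rpow_inv (hμ.nonneg _) hp.ne']

end IsPNorm

namespace IsOfAlmostUniversalDisposition

variable {p : ℝ} {𝕜 : Type} [RCLike 𝕜] {G : Type u} [AddCommGroup G] [Module 𝕜 G] [Norm G]
  {F : Type w} [AddCommGroup F] [Module 𝕜 F] [FiniteDimensional 𝕜 F] {ν : F → ℝ}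

/-- Allows `F` to be renormed freely: the metric comes from `ν`, and completeness is automatic in
finite dimension. -/
theorem exists_of_isPNorm (hG : IsOfAlmostUniversalDisposition.{u, w} p 𝕜 G) (hν : IsPNorm p 𝕜 ν)
    (X : Submodule 𝕜 G) (g : X →ₗ[𝕜] F) (hg : ∀ x : X, ν (g x) = ‖(x : G)‖) {ε : ℝ}
    (h0 : 0 < ε) (h1 : ε < 1) :
    ∃ f : F →ₗ[𝕜] G, (∀ y, (1 - ε) * ν y ≤ ‖f y‖ ∧ ‖f y‖ ≤ (1 + ε) * ν y) ∧
      ∀ x : X, f (g x) = (x : G) := by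
  let _ : Norm F := ⟨ν⟩
  let _ : MetricSpace F := hν.metricSpace
  have hF : IsPNormedSpace p 𝕜 F :=
    ⟨hν.p_pos, hν.p_le_one, hν.nonneg, hν.eq_zero, hν.smul, hν.add_rpow_le, fun _ _ => rfl⟩
  have := IsPNormedSpace.completeSpace_of_finiteDimensional p 𝕜 F
  exact hG F X g hg ε h0 h1

/-- A `δ`-isometry into a space of almost universal disposition, defined on a subspace of a
finite-dimensional space, extends to an almost isometry. -/
theorem exists_extension [MetricSpace G] [IsPNormedSpace p 𝕜 G]
    (hG : IsOfAlmostUniversalDisposition.{u, w} p 𝕜 G) (hν : IsPNorm p 𝕜 ν)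
    (E : Submodule 𝕜 F) (L : E →ₗ[𝕜] G) {δ : ℝ} (hδ0 : 0 < δ) (hδ1 : δ < 1)
    (hL : ∀ x : E, (1 - δ) * ν x ≤ ‖L x‖ ∧ ‖L x‖ ≤ (1 + δ) * ν x) :
    ∃ f : F →ₗ[𝕜] G, (∀ y, (1 - δ) ^ 2 * ν y ≤ ‖f y‖ ∧ ‖f y‖ ≤ (1 + δ) ^ 2 * ν y) ∧
      ∀ x : E, f x = L x := by
  obtain ⟨ν', hν', hb, hE⟩ :=
    hν.exists_renorming (IsPNormedSpace.isPNorm p 𝕜 G) E L hδ0 hδ1 hL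
  have hinj : Function.Injective L := by
    rw [injective_iff_map_eq_zero]
    intro x hx
    have h1 := hE x
    rw [hx, pnorm_zero p 𝕜 G] at h1
    exact Subtype.ext (hν'.eq_zero _ h1)
  let e := LinearEquiv.ofInjective L hinj
  -- For the new `p`-norm, the inverse of `L` is an isometry from `L(E)`, a subspace of `G`, into
  -- `F`.
  obtain ⟨f, hf, hfx⟩ := hG.exists_of_isPNorm hν' (LinearMap.range L)
    (E.subtype.comp e.symm.toLinearMap) (fun x => by
      obtain ⟨z, rfl⟩ := e.surjective x
      simpa [e] using hE z) hδ0 hδ1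
  refine ⟨f, fun y => ⟨?_, ?_⟩, fun x => ?_⟩
  · calc (1 - δ) ^ 2 * ν y = (1 - δ) * ((1 - δ) * ν y) := by ring
      _ ≤ (1 - δ) * ν' y := mul_le_mul_of_nonneg_left (hb y).1 (by linarith)
      _ ≤ ‖f y‖ := (hf y).1
  · calc ‖f y‖ ≤ (1 + δ) * ν' y := (hf y).2
      _ ≤ (1 + δ) * ((1 + δ) * ν y) := mul_le_mul_of_nonneg_left (hb y).2 (by linarith)
      _ = (1 + δ) ^ 2 * ν y := by ring
  · simpa [e] using hfx (e x)

end IsOfAlmostUniversalDisposition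

/-! ### Extension from dense subspaces. -/

namespace IsPNormedSpace

variable (p : ℝ) (𝕜 : Type) [RCLike 𝕜]

theorem isometry_of_norm_map {X Y : Type*} [AddCommGroup X] [Module 𝕜 X] [Norm X] [MetricSpace X]
    [hX : IsPNormedSpace p 𝕜 X] [AddCommGroup Y] [Module 𝕜 Y] [Norm Y] [MetricSpace Y]
    [hY : IsPNormedSpace p 𝕜 Y] (f : X →ₗ[𝕜] Y) (hf : ∀ x, ‖f x‖ = ‖x‖) : Isometry f :=
  Isometry.of_dist_eq fun x y => by rw [hX.dist_eq, hY.dist_eq, ← map_sub, hf]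

/-- An isometry defined on a dense subspace extends to the whole space. -/
theorem exists_isometry_extension {X Y : Type*} [AddCommGroup X] [Module 𝕜 X] [Norm X]
    [MetricSpace X] [hX : IsPNormedSpace p 𝕜 X] [AddCommGroup Y] [Module 𝕜 Y] [Norm Y]
    [MetricSpace Y] [hY : IsPNormedSpace p 𝕜 Y] [CompleteSpace Y] (W : Submodule 𝕜 X)
    (hW : Dense (W : Set X)) (F : W →ₗ[𝕜] Y) (hF : ∀ x : W, ‖F x‖ = ‖(x : X)‖) :
    ∃ f : X →ₗ[𝕜] Y, (∀ x, ‖f x‖ = ‖x‖) ∧ ∀ x : W, f x = F x := by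
  have := isUniformAddGroup p 𝕜 X
  have := isUniformAddGroup p 𝕜 Y
  have := continuousSMul p 𝕜 X
  have := continuousSMul p 𝕜 Y
  have : IsUniformAddGroup W := inferInstanceAs (IsUniformAddGroup W.toAddSubgroup)
  have hFi : Isometry F := Isometry.of_dist_eq fun x y => by
    rw [hY.dist_eq, Subtype.dist_eq, hX.dist_eq, ← map_sub, hF]
    rfl
  let F' : W →L[𝕜] Y := ⟨F, hFi.continuous⟩
  have hd : DenseRange W.subtypeL := by
    show Dense (Set.range W.subtypeL)
    simpa using hW
  have he : IsUniformInducing W.subtypeL := isUniformEmbedding_subtype_val.isUniformInducing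
  let f := F'.extend W.subtypeL
  have hfe : ∀ x : W, f x = F x := fun x => F'.extend_eq hd he x
  refine ⟨f.toLinearMap, fun x => ?_, hfe⟩
  have hcl : IsClosed {x : X | ‖f x‖ = ‖x‖} :=
    isClosed_eq ((continuous_norm p 𝕜 Y).comp f.continuous) (continuous_norm p 𝕜 X)
  have hsub : (W : Set X) ⊆ {x : X | ‖f x‖ = ‖x‖} := fun x hx => by
    show ‖f x‖ = ‖x‖
    rw [hfe ⟨x, hx⟩, hF]
  exact hcl.closure_subset_iff.2 hsub (hW x)

/-- A sequence in a separable space that is dense in the space and whose intersection with a given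
set is dense in that set. -/
theorem exists_seq_dense_inter (Y : Type*) [MetricSpace Y] [TopologicalSpace.SeparableSpace Y]
    [Nonempty Y] (S : Set Y) : ∃ d : ℕ → Y, DenseRange d ∧ S ⊆ closure (Set.range d ∩ S) := by
  have := UniformSpace.secondCountable_of_separable Y
  obtain ⟨t, htS, htc, ht⟩ :=
    (TopologicalSpace.IsSeparable.of_separableSpace S).exists_countable_dense_subset
  obtain ⟨s, hsc, hs⟩ := TopologicalSpace.exists_countable_dense Y
  obtain ⟨d, hd⟩ := (hsc.union htc).exists_eq_range (hs.nonempty.mono Set.subset_union_left)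
  refine ⟨d, ?_, ht.trans (closure_mono ?_)⟩
  · show Dense (Set.range d)
    rw [← hd]
    exact hs.mono Set.subset_union_left
  · rw [← hd]
    exact Set.subset_inter Set.subset_union_right htS

end IsPNormedSpace

/-! ### Universal disposition for separable spaces. -/

namespace Ultrapower

variable {p : ℝ} {𝕜 : Type} [RCLike 𝕜] {G : Type u} [AddCommGroup G] [Module 𝕜 G] [Norm G]
  [MetricSpace G] [IsPNormedSpace p 𝕜 G] {I : Type*} {U : Ultrafilter I}

/-- A family of linear maps whose values on a subspace `W` converge in norm along the ultrafilter
to the norm of the argument defines an isometry of `W` into the ultrapower. -/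
theorem exists_isometry_of_tendsto {Y : Type*} [AddCommGroup Y] [Module 𝕜 Y] [Norm Y]
    (W : Submodule 𝕜 Y) (f : I → Y →ₗ[𝕜] G)
    (hf : ∀ y ∈ W, Tendsto (fun i => ‖f i y‖) U (𝓝 ‖y‖)) :
    ∃ F : W →ₗ[𝕜] Ultrapower p 𝕜 G U, (∀ y : W, ‖F y‖ = ‖(y : Y)‖) ∧
      ∀ (y : W) (x : boundedFamilies p 𝕜 G I), (∀ᶠ i in U, x.1 i = f i y) → F y = mk x := by
  have hex : ∀ y : W, ∃ x : boundedFamilies p 𝕜 G I, ∀ᶠ i in U, x.1 i = f i y := fun y => by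
    obtain ⟨x, hx, -⟩ := exists_boundedFamily (p := p) (𝕜 := 𝕜) (U := U) (fun i => f i y)
      (((hf y y.2).eventually_lt_const (lt_add_one _)).mono fun i hi => hi.le)
    exact ⟨x, hx⟩
  -- The choice need not be linear in `y`; its class is, since it depends only on the values at
  -- almost every index.
  choose s hs using hex
  refine ⟨⟨⟨fun y => mk (s y), fun y z => ?_⟩, fun c y => ?_⟩, fun y => ?_, fun y x hx => ?_⟩
  · rw [← map_add]
    refine mk_eq_mk_of_eventuallyEq ?_
    filter_upwards [hs y, hs z, hs (y + z)] with i h1 h2 h3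
    show (s (y + z)).1 i = (s y).1 i + (s z).1 i
    rw [h1, h2, h3, Submodule.coe_add, map_add]
  · show mk (s (c • y)) = c • mk (s y)
    rw [← map_smul]
    refine mk_eq_mk_of_eventuallyEq ?_
    filter_upwards [hs y, hs (c • y)] with i h1 h2
    show (s (c • y)).1 i = c • (s y).1 i
    rw [h1, h2, Submodule.coe_smul, map_smul]
  · refine tendsto_nhds_unique (tendsto_norm_mk (U := U) (s y)) ((hf y y.2).congr' ?_)
    filter_upwards [hs y] with i hi
    rw [hi]
  · refine mk_eq_mk_of_eventuallyEq ?_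
    filter_upwards [hs y, hx] with i h1 h2
    rw [h1, h2]

theorem isOfSeparableUniversalDisposition
    (hG : IsOfAlmostUniversalDisposition.{u, w} p 𝕜 G) [CompleteSpace G]
    (hU : IsCountablyIncomplete U) :
    IsOfSeparableUniversalDisposition.{_, w} p 𝕜 (Ultrapower p 𝕜 G U) := by
  intro Y _ _ _ _ hY _ _ X g hg
  have hYn := IsPNormedSpace.isPNorm p 𝕜 Y
  have hGn := IsPNormedSpace.isPNorm p 𝕜 G
  have hQn := IsPNormedSpace.isPNorm p 𝕜 (Ultrapower p 𝕜 G U)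
  have hinj : Function.Injective g := by
    rw [injective_iff_map_eq_zero]
    intro x hx
    have h1 := hg x
    rw [hx, pnorm_zero p 𝕜 Y] at h1
    exact Subtype.ext (hQn.eq_zero _ h1.symm)
  obtain ⟨r, hr⟩ := LinearMap.exists_leftInverse_of_injective g (LinearMap.ker_eq_bot.2 hinj)
  have hr' : ∀ x, r (g x) = x := fun x => LinearMap.congr_fun hr x
  obtain ⟨s, hs⟩ := LinearMap.exists_rightInverse_of_surjective
    (mk : boundedFamilies p 𝕜 G I →ₗ[𝕜] Ultrapower p 𝕜 G U)
    (LinearMap.range_eq_top.2 mk_surjective)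
  have hs' : ∀ q, mk (s q) = q := fun q => LinearMap.congr_fun hs q
  -- Composing with the algebraic left inverse `r` defines `L i` on all of `Y`, without norm
  -- control; only its values on the range of `g` matter.
  let L : I → Y →ₗ[𝕜] G := fun i =>
    (LinearMap.proj i).comp ((boundedFamilies p 𝕜 G I).subtype.comp (s.comp (X.subtype.comp r)))
  have hLr : ∀ i y, L i y = (s (r y)).1 i := fun i y => rfl
  have hL : ∀ y ∈ LinearMap.range g, Tendsto (fun i => ‖L i y‖) U (𝓝 ‖y‖) := by
    rintro _ ⟨x, rfl⟩
    have h1 := tendsto_norm_mk (U := U) (s (r (g x)))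
    rw [hs', hr', ← hg x] at h1
    simpa only [hLr, hr'] using h1
  -- The span of a dense sequence could meet the range of `g` trivially, so enough points of the
  -- range are included to make the identity `f (g x) = x` pass to the limit.
  obtain ⟨d, hd, hdg⟩ := IsPNormedSpace.exists_seq_dense_inter Y (LinearMap.range g : Set Y)
  let V : ℕ → Submodule 𝕜 Y := fun n => Submodule.span 𝕜 (d '' Set.Iio n)
  have hVmono : ∀ n m, n ≤ m → V n ≤ V m := fun n m hnm =>
    Submodule.span_mono (Set.image_mono (Set.Iio_subset_Iio hnm))
  let P : ℕ → I → (Y →ₗ[𝕜] G) → Prop := fun n i f =>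
    (∀ y ∈ V n, (1 - 1 / ((n : ℝ) + 1)) * ‖y‖ ≤ ‖f y‖ ∧ ‖f y‖ ≤ (1 + 1 / ((n : ℝ) + 1)) * ‖y‖) ∧
      ∀ y ∈ V n, y ∈ LinearMap.range g → f y = L i y
  have hanti : ∀ n m i f, n ≤ m → P m i f → P n i f := by
    rintro n m i f hnm ⟨h1, h2⟩
    refine ⟨fun y hy => ?_, fun y hy => h2 y (hVmono n m hnm hy)⟩
    obtain ⟨h3, h4⟩ := h1 y (hVmono n m hnm hy)
    have h5 : 1 / ((m : ℝ) + 1) ≤ 1 / ((n : ℝ) + 1) := by gcongr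
    have h6 := mul_le_mul_of_nonneg_right h5 (hYn.nonneg y)
    constructor <;> nlinarith
  have hP : ∀ n, ∀ᶠ i in U, ∃ f, P n i f := fun n => by
    have hfin : FiniteDimensional 𝕜 (V n) :=
      FiniteDimensional.span_of_finite 𝕜 ((Set.finite_Iio n).image d)
    have hVn : IsPNorm p 𝕜 fun y : V n => ‖(y : Y)‖ :=
      hYn.comp (V n).subtype (V n).subtype_injective
    let E : Submodule 𝕜 (V n) := (LinearMap.range g).comap (V n).subtype
    have hEn : IsPNorm p 𝕜 fun y : E => ‖((y : V n) : Y)‖ := hVn.comp E.subtype E.subtype_injective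
    let ε : ℝ := 1 / ((n : ℝ) + 1)
    have hε0 : 0 < ε := by positivity
    have hε1 : ε ≤ 1 := by
      refine (div_le_one (by positivity)).2 ?_
      linarith [(n.cast_nonneg : (0 : ℝ) ≤ n)]
    -- The extension squares the distortion, and `(1 + ε / 3) ^ 2 ≤ 1 + ε` because `ε ≤ 1`. The
    -- third also keeps `δ < 1` when `n = 0`, where `ε = 1`.
    have hev := hGn.eventually_almost_isometry U hEn
      (fun i => (L i).comp ((V n).subtype.comp E.subtype)) (fun y => hL _ y.2)
      (ε := ε / 3) (by positivity)
    filter_upwards [hev] with i hi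
    obtain ⟨f, hf, hfE⟩ := hG.exists_extension hVn E
      ((L i).comp ((V n).subtype.comp E.subtype)) (δ := ε / 3) (by positivity) (by linarith) hi
    -- An arbitrary linear extension suffices, because condition `n` concerns `V n` only.
    obtain ⟨f', hf'⟩ := LinearMap.exists_extend f
    have hff : ∀ y : V n, f' y = f y := fun y => LinearMap.congr_fun hf' y
    refine ⟨f', fun y hy => ?_, fun y hy hyg => ?_⟩
    · rw [hff ⟨y, hy⟩]
      obtain ⟨h1, h2⟩ := hf ⟨y, hy⟩
      have h0 : 0 ≤ ‖y‖ := hYn.nonneg y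
      refine ⟨le_trans (mul_le_mul_of_nonneg_right ?_ h0) h1,
        h2.trans (mul_le_mul_of_nonneg_right ?_ h0)⟩
      · show 1 - ε ≤ _
        nlinarith
      · show _ ≤ 1 + ε
        nlinarith
    · rw [hff ⟨y, hy⟩]
      exact hfE ⟨⟨y, hy⟩, hyg⟩
  obtain ⟨f, hf⟩ := hU.exists_forall_eventually P hanti hP
  let W : Submodule 𝕜 Y := Submodule.span 𝕜 (Set.range d)
  have hWV : ∀ y ∈ W, ∃ n, y ∈ V n := fun y hy => by
    have hW : W = ⨆ n, V n := by
      show _ = ⨆ n, Submodule.span 𝕜 (d '' Set.Iio n)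
      rw [← Submodule.span_iUnion, ← Set.image_iUnion, Set.iUnion_Iio, Set.image_univ]
    rw [hW] at hy
    exact (Submodule.mem_iSup_of_directed V (directed_of_isDirected_le hVmono)).1 hy
  have hlim : ∀ y ∈ W, Tendsto (fun i => ‖f i y‖) U (𝓝 ‖y‖) := fun y hy => by
    obtain ⟨n, hn⟩ := hWV y hy
    have h0 : 0 ≤ ‖y‖ := hYn.nonneg y
    have hz := tendsto_one_div_add_atTop_nhds_zero_nat (𝕜 := ℝ)
    have hl : Tendsto (fun m : ℕ => (1 - 1 / ((m : ℝ) + 1)) * ‖y‖) atTop (𝓝 ‖y‖) := by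
      simpa using (hz.const_sub 1).mul_const ‖y‖
    have hu : Tendsto (fun m : ℕ => (1 + 1 / ((m : ℝ) + 1)) * ‖y‖) atTop (𝓝 ‖y‖) := by
      simpa using (hz.const_add 1).mul_const ‖y‖
    rw [tendsto_order]
    constructor
    · intro a ha
      obtain ⟨m, hm, hnm⟩ := ((hl.eventually_const_lt ha).and (eventually_ge_atTop n)).exists
      filter_upwards [hf m] with i hi
      exact hm.trans_le (hi.1 y (hVmono n m hnm hn)).1
    · intro a ha
      obtain ⟨m, hm, hnm⟩ := ((hu.eventually_lt_const ha).and (eventually_ge_atTop n)).exists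
      filter_upwards [hf m] with i hi
      exact (hi.1 y (hVmono n m hnm hn)).2.trans_lt hm
  obtain ⟨F, hFn, hF⟩ := exists_isometry_of_tendsto (p := p) W f hlim
  obtain ⟨Φ, hΦ, hΦW⟩ := IsPNormedSpace.exists_isometry_extension p 𝕜 W
    (hd.mono Submodule.subset_span) F hFn
  have hfix : ∀ x : X, g x ∈ W → Φ (g x) = x := fun x hx => by
    rw [hΦW ⟨g x, hx⟩, hF ⟨g x, hx⟩ (s (r (g x))), hs', hr']
    obtain ⟨n, hn⟩ := hWV _ hx
    filter_upwards [hf n] with i hi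
    rw [← hLr]
    exact (hi.2 _ hn ⟨x, rfl⟩).symm
  refine ⟨Φ, hΦ, fun x => ?_⟩
  -- A general `g x` is a limit of points of the range of `g` that lie in `W`; there `Φ` already
  -- inverts `g`, and both maps are isometric.
  obtain ⟨z, hz, hzlim⟩ := mem_closure_iff_seq_limit.1 (hdg ⟨x, rfl⟩)
  choose t ht using fun n => (hz n).2
  have h1 : Tendsto (fun n => Φ (g (t n))) atTop (𝓝 (Φ (g x))) := by
    simp_rw [ht]
    exact ((IsPNormedSpace.isometry_of_norm_map p 𝕜 Φ hΦ).continuous.tendsto _).comp hzlim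
  have h2 : Tendsto (fun n => ((t n : X) : Ultrapower p 𝕜 G U)) atTop (𝓝 x) := by
    rw [tendsto_iff_dist_tendsto_zero] at hzlim ⊢
    refine hzlim.congr fun n => ?_
    rw [hY.dist_eq, (isPNormedSpace (p := p) (𝕜 := 𝕜) (X := G) (U := U)).dist_eq, ← ht, ← map_sub,
      hg]
    rfl
  refine tendsto_nhds_unique (h1.congr fun n => hfix _ ?_) h2
  rw [ht]
  exact Submodule.subset_span (hz n).1

end Ultrapower

/-! ### The density character. -/

/-- A norm is a `p`-norm for every `p ∈ (0, 1]`. -/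
theorem IsPNorm.of_normedSpace {p : ℝ} {𝕜 : Type} [RCLike 𝕜] {F : Type*} [NormedAddCommGroup F]
    [NormedSpace 𝕜 F] (hp : 0 < p) (hp1 : p ≤ 1) : IsPNorm p 𝕜 fun x : F => ‖x‖ where
  p_pos := hp
  p_le_one := hp1
  nonneg := norm_nonneg
  eq_zero _ hx := norm_eq_zero.1 hx
  smul := norm_smul
  add_rpow_le x y :=
    (Real.rpow_le_rpow (norm_nonneg _) (norm_add_le x y) hp.le).trans
      (Real.rpow_add_le_add_rpow (norm_nonneg _) (norm_nonneg _) hp.le hp1)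

/-- A point is determined by its distances to a dense sequence, so the space injects into `ℕ → ℝ`.
-/
theorem mk_le_continuum_of_separable (X : Type u) [MetricSpace X]
    [TopologicalSpace.SeparableSpace X] : #X ≤ 𝔠 := by
  rcases isEmpty_or_nonempty X with hX | hX
  · simp
  have hinj : Function.Injective fun (x : X) (n : ℕ) => dist x (TopologicalSpace.denseSeq X n) := by
    intro x y hxy
    have hc : (fun z => dist x z) = fun z => dist y z :=
      (TopologicalSpace.denseRange_denseSeq X).equalizer (continuous_const.dist continuous_id)
        (continuous_const.dist continuous_id) hxy
    have := congrFun hc y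
    rw [dist_self] at this
    exact dist_eq_zero.1 this
  have h1 := Cardinal.lift_mk_le_lift_mk_of_injective hinj
  simpa [Cardinal.mk_real] using h1

/-- If a space contains a family of `ι` many points that are uniformly separated, then its density
character is at least `#ι`. -/
theorem lift_mk_le_lift_densityCharacter {X : Type u} [MetricSpace X] {ι : Type w} (x : ι → X)
    {δ : ℝ} (hδ : 0 < δ) (hx : ∀ i j, i ≠ j → δ ≤ dist (x i) (x j)) :
    Cardinal.lift.{u} #ι ≤ Cardinal.lift.{w} (densityCharacter X) := by
  have hne : {κ : Cardinal.{u} | ∃ s : Set X, Dense s ∧ #s = κ}.Nonempty :=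
    ⟨_, Set.univ, dense_univ, rfl⟩
  obtain ⟨s, hs, hcard⟩ := csInf_mem hne
  rw [densityCharacter, ← hcard]
  choose y hy hd using fun i => hs.exists_dist_lt (x i) (half_pos hδ)
  refine Cardinal.lift_mk_le_lift_mk_of_injective (f := fun i => (⟨y i, hy i⟩ : s)) fun i j hij => ?_
  by_contra hne
  have h1 : y i = y j := congrArg Subtype.val hij
  have h2 := dist_triangle_right (x i) (x j) (y i)
  have h3 := hd i
  have h4 := hd j
  rw [← h1] at h4
  linarith [hx i j hne]

/-- A space of almost universal disposition contains arbitrarily large finite sets of uniformly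
bounded and uniformly separated points. -/
theorem IsOfAlmostUniversalDisposition.exists_separated {p : ℝ} {𝕜 : Type} [RCLike 𝕜] {G : Type u}
    [AddCommGroup G] [Module 𝕜 G] [Norm G] [MetricSpace G] [h : IsPNormedSpace p 𝕜 G]
    (hG : IsOfAlmostUniversalDisposition.{u, w} p 𝕜 G) (ι : Type) [Fintype ι] :
    ∃ a : ι → G, (∀ i, ‖a i‖ ≤ 2) ∧ ∀ i j, i ≠ j → 1 / 2 ≤ ‖a i - a j‖ := by
  classical
  -- The zero subspace of `G` is extended to a sup-normed coordinate space, in which the unit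
  -- vectors are at distance at least `1`; a `1/2`-isometry keeps half of that. `ULift` only adjusts
  -- the universe.
  have hν : IsPNorm p 𝕜 fun x : ι → ULift.{w} 𝕜 => ‖x‖ :=
    IsPNorm.of_normedSpace h.p_pos h.p_le_one
  have : FiniteDimensional 𝕜 (ULift.{w} 𝕜) := Module.Finite.equiv ULift.moduleEquiv.symm
  obtain ⟨f, hf, -⟩ := hG.exists_of_isPNorm hν ⊥ 0
    (fun x => by
      rw [(Submodule.mem_bot 𝕜).1 x.2, pnorm_zero p 𝕜 G]
      simp) (ε := 1 / 2) (by norm_num) (by norm_num)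
  have hone : ‖(ULift.up 1 : ULift.{w} 𝕜)‖ = 1 := by simp [ULift.norm_def]
  refine ⟨fun i => f (Pi.single i (ULift.up 1)), fun i => ?_, fun i j hij => ?_⟩
  · have h1 := (hf (Pi.single i (ULift.up 1))).2
    rw [Pi.norm_single, hone] at h1
    linarith
  · rw [← map_sub]
    refine le_trans ?_ (hf _).1
    have h1 := norm_le_pi_norm
      (Pi.single i (ULift.up 1) - Pi.single j (ULift.up 1) : ι → ULift.{w} 𝕜) i
    rw [Pi.sub_apply, Pi.single_eq_same, Pi.single_eq_of_ne hij, sub_zero, hone] at h1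
    linarith

namespace Ultrapower

variable {p : ℝ} {𝕜 : Type} [RCLike 𝕜] {G : Type u} [AddCommGroup G] [Module 𝕜 G] [Norm G]
  [MetricSpace G] [h : IsPNormedSpace p 𝕜 G]

theorem mk_le_continuum [TopologicalSpace.SeparableSpace G] {I : Type} [Countable I]
    {U : Ultrafilter I} : #(Ultrapower p 𝕜 G U) ≤ 𝔠 := by
  calc #(Ultrapower p 𝕜 G U) ≤ #(boundedFamilies p 𝕜 G I) := mk_le_of_surjective mk_surjective
    _ ≤ #(I → G) := mk_subtype_le _
    _ = #G ^ Cardinal.lift.{u} #I := by simp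
    _ ≤ 𝔠 ^ ℵ₀ := by
      refine (Cardinal.power_le_power_right (mk_le_continuum_of_separable G)).trans
        (Cardinal.power_le_power_left continuum_ne_zero ?_)
      rw [Cardinal.lift_le_aleph0]
      exact mk_le_aleph0
    _ = 𝔠 := continuum_power_aleph0

/-- At stage `n`, sequences are sent to one of `2 ^ n` separated points according to their first `n`
digits. Saturation merges the stages, and distinct sequences are separated from some stage on. -/
theorem exists_separated {I : Type*} {U : Ultrafilter I}
    (hG : IsOfAlmostUniversalDisposition.{u, w} p 𝕜 G) (hU : IsCountablyIncomplete U) :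
    ∃ x : (ℕ → Bool) → Ultrapower p 𝕜 G U, ∀ σ τ, σ ≠ τ → (1 / 2 : ℝ) ^ p ≤ dist (x σ) (x τ) := by
  let P : ℕ → I → ((ℕ → Bool) → G) → Prop := fun n _ a =>
    (∀ σ, ‖a σ‖ ≤ 2) ∧ ∀ σ τ, (∃ k < n, σ k ≠ τ k) → 1 / 2 ≤ ‖a σ - a τ‖
  have hanti : ∀ n m i a, n ≤ m → P m i a → P n i a := by
    rintro n m i a hnm ⟨h1, h2⟩
    exact ⟨h1, fun σ τ ⟨k, hk, hne⟩ => h2 σ τ ⟨k, hk.trans_le hnm, hne⟩⟩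
  have hP : ∀ n, ∀ᶠ i in U, ∃ a, P n i a := fun n => by
    obtain ⟨b, hb, hsep⟩ := hG.exists_separated (Fin n → Bool)
    refine Eventually.of_forall fun i => ⟨fun σ => b fun k => σ k, fun σ => hb _, ?_⟩
    rintro σ τ ⟨k, hk, hne⟩
    exact hsep _ _ fun heq => hne (congrFun heq ⟨k, hk⟩)
  obtain ⟨a, ha⟩ := hU.exists_forall_eventually P hanti hP
  choose y hy hyb using fun σ => exists_boundedFamily (p := p) (𝕜 := 𝕜) (U := U)
    (fun i => a i σ) ((ha 0).mono fun i hi => hi.1 σ)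
  refine ⟨fun σ => mk (y σ), fun σ τ hne => ?_⟩
  obtain ⟨k, hk⟩ := Function.ne_iff.1 hne
  have hlim := tendsto_norm_mk (U := U) (y σ - y τ)
  rw [map_sub] at hlim
  refine Real.rpow_le_rpow (by norm_num) (ge_of_tendsto hlim ?_) h.p_pos.le
  -- Condition `n` sees only the digits below `n`, so a difference at digit `k` is detected at stage
  -- `k + 1`.
  filter_upwards [ha (k + 1), hy σ, hy τ] with i h1 h2 h3
  show 1 / 2 ≤ ‖(y σ).1 i - (y τ).1 i‖
  rw [h2, h3]
  exact h1.2 σ τ ⟨k, Nat.lt_succ_self k, hk⟩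

theorem densityCharacter_eq_continuum [TopologicalSpace.SeparableSpace G] {I : Type} [Countable I]
    {U : Ultrafilter I} (hG : IsOfAlmostUniversalDisposition.{u, w} p 𝕜 G)
    (hU : IsCountablyIncomplete U) : densityCharacter (Ultrapower p 𝕜 G U) = 𝔠 := by
  refine le_antisymm ?_ ?_
  · have hm : #(Set.univ : Set (Ultrapower p 𝕜 G U)) ∈
        {κ | ∃ s : Set (Ultrapower p 𝕜 G U), Dense s ∧ #s = κ} := ⟨_, dense_univ, rfl⟩
    refine (csInf_le' hm).trans ?_
    rw [mk_univ]
    exact mk_le_continuum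
  · obtain ⟨x, hx⟩ := exists_separated hG hU
    have h1 := lift_mk_le_lift_densityCharacter x (Real.rpow_pos_of_pos (by norm_num) p) hx
    simpa using h1

end Ultrapower

theorem proposition7p2 (p : ℝ) (𝕜 : Type) [RCLike 𝕜]
    (G : Type u) [AddCommGroup G] [Module 𝕜 G] [Norm G] [MetricSpace G]
    [IsPNormedSpace p 𝕜 G] [CompleteSpace G] [TopologicalSpace.SeparableSpace G]
    (hG : IsOfAlmostUniversalDisposition.{u, w} p 𝕜 G)
    (U : Ultrafilter ℤ) (hU : IsCountablyIncomplete U) :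
    (IsPNormedSpace p 𝕜 (Ultrapower p 𝕜 G U) ∧ CompleteSpace (Ultrapower p 𝕜 G U)) ∧
      IsOfSeparableUniversalDisposition.{u, w} p 𝕜 (Ultrapower p 𝕜 G U) ∧
      densityCharacter (Ultrapower p 𝕜 G U) = Cardinal.continuum :=
  ⟨⟨inferInstance, inferInstance⟩, Ultrapower.isOfSeparableUniversalDisposition hG hU,
    Ultrapower.densityCharacter_eq_continuum hG hU⟩
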